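/- Let $n\ge 0$ and $[n]=\{1,\dots,n\}$. Let $\mathcal{T}_n$ be the arrangement in $\mathbb{R}^n$ of the hyperplanes $x_i+x_j=0$ $(1\le i<j\le n)$, and let $\mathcal{BT}_n$ consist of these hyperplanes together with $x_i=-\frac12$ and $x_i=\frac12$ $(1\le i\le n)$. A region of an arrangement is a connected component of the complement of the union of its hyperplanes. Threshold graphs are defined recursively: the graph with no vertices is a threshold graph, and a graph obtained from a threshold graph by adding an isolated vertex, or a vertex adjacent to all previous vertices, is a threshold graph. Colored threshold graphs (each vertex is red, blue or uncolored) are defined recursively: the graph with no vertices is one, and a graph obtained from one by adding an isolated (respectively, adjacent to all previous vertices) vertex is one, where the new vertex must be red (respectively, blue) if the previous graph has a colored vertex, and may be either uncolored or red (respectively, uncolored or blue) if it has none. A labeled (colored) threshold graph on $n$ vertices is a (colored) threshold graph with vertex set $[n]$. Then there is a bijection $\Phi$ from the labeled colored threshold graphs on $n$ vertices to the regions of $\mathcal{BT}_n$ and a bijection $\Psi$ from the labeled threshold graphs on $n$ vertices to the regions of $\mathcal{T}_n$ such that: 1. A point $x$ on no hyperplane of $\mathcal{BT}_n$ lies in $\Phi(C)$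 if and only if, for all $i\ne j$, $x_i+x_j>0$ exactly when $ij$ is an edge of $C$, and, for all $i$, $x_i>\frac12$ exactly when $i$ is blue, $x_i<-\frac12$ exactly when $i$ is red, and $|x_i|<\frac12$ exactly when $i$ is uncolored. 2. A point $x$ on no hyperplane of $\mathcal{T}_n$ lies in $\Psi(G)$ if and only if, for all $i\ne j$, $x_i+x_j>0$ exactly when $ij$ is an edge of $G$. 3. For every labeled colored threshold graph $C$, the underlying graph $\overline{C}$ obtained by forgetting the colors is a labeled threshold graph, and $\Psi(\overline{C})$ is the unique region of $\mathcal{T}_n$ that contains $\Phi(C)$. 4. The region $\Phi(C)$ is bounded if and only if no vertex of $C$ is colored. The map $\Phi(C)\mapsto\Psi(\overline{C})$ restricts to a bijection from the bounded regions of $\mathcal{BT}_n$ to the regions of $\mathcal{T}_n$, and the bounded region corresponding to a region $R$ of $\mathcal{T}_n$ is $R\cap(-\frac12,\frac12)^n$. -/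

import Mathlib

/-! ### Hyperplane arrangements and their regions

Points of `ℝⁿ` are functions `Fin n → ℝ`; only the topology and the bounded sets of `ℝⁿ` are used,
and these do not depend on the choice of a norm. -/

/-- The threshold arrangement: the hyperplanes `x_i + x_j = 0` for `i < j`. -/
def thresholdArrangement (n : ℕ) : Set (Set (Fin n → ℝ)) :=
  {H | ∃ i j : Fin n, i < j ∧ H = {x | x i + x j = 0}}

/-- The boxed threshold arrangement: the hyperplanes `x_i + x_j = 0` for `i < j`, together with
`x_i = -1/2` and `x_i = 1/2` for all `i`. -/
def boxedThresholdArrangement (n : ℕ) : Set (Set (Fin n → ℝ)) :=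
  thresholdArrangement n ∪
    {H | ∃ i : Fin n, H = {x | x i = -(1 / 2)} ∨ H = {x | x i = 1 / 2}}

/-- The complement in `ℝⁿ` of the union of the hyperplanes of `A`. -/
def arrangementComplement {n : ℕ} (A : Set (Set (Fin n → ℝ))) : Set (Fin n → ℝ) :=
  (⋃₀ A)ᶜ

/-- The regions of `A`: the connected components of the complement. -/
def arrangementRegions {n : ℕ} (A : Set (Set (Fin n → ℝ))) : Set (Set (Fin n → ℝ)) :=
  {R | ∃ x ∈ arrangementComplement A, R = connectedComponentIn (arrangementComplement A) x}

/-! ### Threshold graphs -/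

/-- Threshold graphs: the graph without vertices is one, and `G` is one as soon as it is obtained
from a threshold graph (namely `G` with the vertex `v` deleted) by adding a vertex `v` that is
isolated, or that is adjacent to all other vertices. -/
inductive IsThresholdGraph : ∀ {V : Type}, SimpleGraph V → Prop
  | empty {V : Type} [IsEmpty V] (G : SimpleGraph V) : IsThresholdGraph G
  | addIsolated {V : Type} (G : SimpleGraph V) (v : V)
      (h : IsThresholdGraph (G.induce {w | w ≠ v}))
      (hv : ∀ w, w ≠ v → ¬ G.Adj v w) : IsThresholdGraph G
  | addDominating {V : Type} (G : SimpleGraph V) (v : V)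
      (h : IsThresholdGraph (G.induce {w | w ≠ v}))
      (hv : ∀ w, w ≠ v → G.Adj v w) : IsThresholdGraph G

/-- Labeled threshold graphs on `n` vertices. -/
def LabeledThresholdGraph (n : ℕ) : Type :=
  {G : SimpleGraph (Fin n) // IsThresholdGraph G}

/-! ### Colored threshold graphs -/

/-- The two colors of vertices. -/
inductive VertexColor : Type
  | red
  | blue

/-- A graph some of whose vertices are colored red or blue; `none` means uncolored. -/
structure ColoredGraph (V : Type) where
  graph : SimpleGraph V
  color : V → Option VertexColor

/-- Deletion of a vertex from a colored graph. -/
def ColoredGraph.deleteVertex {V : Type} (C : ColoredGraph V) (v : V) :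
    ColoredGraph {w : V | w ≠ v} where
  graph := C.graph.induce {w | w ≠ v}
  color w := C.color w

/-- The graph has a colored vertex. -/
def ColoredGraph.HasColored {V : Type} (C : ColoredGraph V) : Prop :=
  ∃ v, C.color v ≠ none

/-- Colored threshold graphs: the graph without vertices is one, and `C` is one as soon as it is
obtained from a colored threshold graph (`C` with the vertex `v` deleted) by adding a vertex `v`
that is isolated, or adjacent to all other vertices. If there already was a colored vertex, a new
isolated vertex is red and a new dominating vertex is blue; if there was none, the new vertex is
either uncolored or has that color. -/
inductive IsColoredThresholdGraph : ∀ {V : Type}, ColoredGraph V → Prop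
  | empty {V : Type} [IsEmpty V] (C : ColoredGraph V) : IsColoredThresholdGraph C
  | addIsolated {V : Type} (C : ColoredGraph V) (v : V)
      (h : IsColoredThresholdGraph (C.deleteVertex v))
      (hv : ∀ w, w ≠ v → ¬ C.graph.Adj v w)
      (hc : (C.deleteVertex v).HasColored → C.color v = some VertexColor.red)
      (hc' : ¬ (C.deleteVertex v).HasColored →
        C.color v = none ∨ C.color v = some VertexColor.red) :
      IsColoredThresholdGraph C
  | addDominating {V : Type} (C : ColoredGraph V) (v : V)
      (h : IsColoredThresholdGraph (C.deleteVertex v))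
      (hv : ∀ w, w ≠ v → C.graph.Adj v w)
      (hc : (C.deleteVertex v).HasColored → C.color v = some VertexColor.blue)
      (hc' : ¬ (C.deleteVertex v).HasColored →
        C.color v = none ∨ C.color v = some VertexColor.blue) :
      IsColoredThresholdGraph C

/-- Labeled colored threshold graphs on `n` vertices. -/
def LabeledColoredThresholdGraph (n : ℕ) : Type :=
  {C : ColoredGraph (Fin n) // IsColoredThresholdGraph C}

theorem IsColoredThresholdGraph.isThresholdGraph {V : Type} {C : ColoredGraph V}
    (h : IsColoredThresholdGraph C) : IsThresholdGraph C.graph := by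
  induction h with
  | empty C => exact .empty _
  | addIsolated C v _ hv _ _ ih => exact .addIsolated _ v ih hv
  | addDominating C v _ hv _ _ ih => exact .addDominating _ v ih hv

/-- Forgetting the colors. -/
def LabeledColoredThresholdGraph.forgetColors {n : ℕ} (C : LabeledColoredThresholdGraph n) :
    LabeledThresholdGraph n :=
  ⟨C.1.graph, C.2.isThresholdGraph⟩

/-!
A point `x` off the hyperplanes determines a graph on its coordinates, with an edge `ij` when
`0 < x i + x j`, and a coloring: blue above `1/2`, red below `-1/2`, uncolored in between. Both
bijections send a (colored) graph to the set of points that determine it.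

* These sets are the regions: for any family of affine hyperplanes, the connected component of a
  point in the complement consists of the points lying on the same side of every hyperplane
  (`connectedComponentIn_compl_hyperplanes`). One inclusion is convexity, the other is the
  intermediate value theorem.
* The graph of a point is a colored threshold graph (`isColoredThresholdGraph_coloredSumGraph`):
  a coordinate `x v` of largest absolute value decides the sign of every sum `x v + x w`, so `v` is
  dominating or isolated according to the sign of `x v`, and it is colored if anything is.
* Every colored threshold graph arises (`IsColoredThresholdGraph.exists_coloredSumGraph_eq`): each
  new vertex gets a coordinate of larger absolute value than all previous ones, which is kept below
  `1/2` as long as nothing is colored.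

Forgetting the colors of the graph of a point leaves its graph, so the uncolored statements follow
from the colored ones: a threshold graph is a colored one without colors, and the points of its
bounded region are those that determine this graph and lie in the cube `(-1/2, 1/2)ⁿ`.
A region with a colored vertex is unbounded because the blue coordinates can be increased and the
red ones decreased by any common amount.
-/

/-! ### Components of the complement of a family of hyperplanes -/

theorem connectedComponentIn_compl_hyperplanes {ι E : Type*} [AddCommGroup E] [Module ℝ E]
    [TopologicalSpace E] [ContinuousAdd E] [ContinuousSMul ℝ E] (l : ι → E →L[ℝ] ℝ) (c : ι → ℝ)
    {x : E} (hx : ∀ i, l i x ≠ c i) :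
    connectedComponentIn {y | ∀ i, l i y ≠ c i} x =
      {y | (∀ i, l i y ≠ c i) ∧ ∀ i, c i < l i y ↔ c i < l i x} := by
  apply Set.Subset.antisymm
  · intro y hy
    refine ⟨connectedComponentIn_subset _ _ hy, fun i => ?_⟩
    have hconn : (l i '' connectedComponentIn {y | ∀ i, l i y ≠ c i} x).OrdConnected :=
      (isPreconnected_connectedComponentIn.image _ (l i).continuous.continuousOn).ordConnected
    have hxmem := Set.mem_image_of_mem (l i)
      (mem_connectedComponentIn (F := {y | ∀ i, l i y ≠ c i}) hx)
    have hymem := Set.mem_image_of_mem (l i) hy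
    have hc : c i ∉ l i '' connectedComponentIn {y | ∀ i, l i y ≠ c i} x := by
      rintro ⟨z, hz, hzc⟩
      exact connectedComponentIn_subset _ _ hz i hzc
    constructor
    · intro h
      by_contra! h'
      exact hc (hconn.out hxmem hymem ⟨h', h.le⟩)
    · intro h
      by_contra! h'
      exact hc (hconn.out hymem hxmem ⟨h', h.le⟩)
  -- Each side of a hyperplane is convex, so the right-hand side is connected.
  · have hconv : Convex ℝ {y | (∀ i, l i y ≠ c i) ∧ ∀ i, c i < l i y ↔ c i < l i x} := by
      have heq : {y | (∀ i, l i y ≠ c i) ∧ ∀ i, c i < l i y ↔ c i < l i x} =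
          ⋂ i, l i ⁻¹' (if c i < l i x then Set.Ioi (c i) else Set.Iio (c i)) := by
        ext y
        simp only [Set.mem_ofPred_eq, Set.mem_iInter, Set.mem_preimage, ← forall_and]
        refine forall_congr' fun i => ?_
        split_ifs with h
        · simpa [h] using fun h' : c i < l i y => h'.ne'
        · simpa [h] using (lt_iff_le_and_ne.trans and_comm).symm
      rw [heq]
      refine convex_iInter fun i => ?_
      apply Convex.is_linear_preimage _ (l i).toLinearMap.isLinear
      split_ifs
      · exact convex_Ioi _
      · exact convex_Iio _
    exact hconv.isPreconnected.subset_connectedComponentIn ⟨hx, fun _ => Iff.rfl⟩ fun y hy => hy.1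

/-- If the regions of `A` are the fibers of a map `q` on the complement, then the regions are in
bijection with the values of `q`. -/
theorem exists_equiv_arrangementRegions {n : ℕ} {A : Set (Set (Fin n → ℝ))} {α : Type*}
    (P : α → Prop) (q : (Fin n → ℝ) → α)
    (hcomp : ∀ x ∈ arrangementComplement A, connectedComponentIn (arrangementComplement A) x =
      {y | y ∈ arrangementComplement A ∧ q y = q x})
    (hP : ∀ x ∈ arrangementComplement A, P (q x))
    (hsurj : ∀ a, P a → ∃ x ∈ arrangementComplement A, q x = a) :
    ∃ e : {a // P a} ≃ arrangementRegions A, ∀ a,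
      (e a : Set (Fin n → ℝ)) = {x | x ∈ arrangementComplement A ∧ q x = a.1} := by
  let f : {a // P a} → arrangementRegions A := fun a =>
    ⟨{x | x ∈ arrangementComplement A ∧ q x = a.1}, by
      obtain ⟨x, hx, hxa⟩ := hsurj a.1 a.2
      exact ⟨x, hx, by rw [hcomp x hx, hxa]⟩⟩
  refine ⟨Equiv.ofBijective f ⟨?_, ?_⟩, fun a => rfl⟩
  · intro a b hab
    obtain ⟨x, hx, hxa⟩ := hsurj a.1 a.2
    have hmem : x ∈ (f b : Set (Fin n → ℝ)) := hab ▸ (⟨hx, hxa⟩ : x ∈ (f a : Set (Fin n → ℝ)))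
    exact Subtype.ext (hxa.symm.trans hmem.2)
  · rintro ⟨R, x, hx, rfl⟩
    exact ⟨⟨q x, hP x hx⟩, Subtype.ext (hcomp x hx).symm⟩

/-! ### The colored graph of a point -/

/-- The graph with an edge `ij` when `0 < x i + x j`. -/
def sumGraph {V : Type} (x : V → ℝ) : SimpleGraph V where
  Adj i j := i ≠ j ∧ 0 < x i + x j
  symm := ⟨fun i j h => ⟨h.1.symm, by linarith [h.2]⟩⟩
  loopless := ⟨fun _ h => h.1 rfl⟩

open Classical in
/-- The color of a coordinate `t`: blue above `1/2`, red below `-1/2`. -/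
noncomputable def coordinateColor (t : ℝ) : Option VertexColor :=
  if 1 / 2 < t then some .blue else if t < -(1 / 2) then some .red else none

/-- The graph of a point together with the colors of its coordinates. -/
noncomputable def coloredSumGraph {V : Type} (x : V → ℝ) : ColoredGraph V where
  graph := sumGraph x
  color v := coordinateColor (x v)

theorem coordinateColor_eq_blue_iff {t : ℝ} : coordinateColor t = some .blue ↔ 1 / 2 < t := by
  unfold coordinateColor
  split_ifs <;> simp_all

theorem coordinateColor_eq_red_iff {t : ℝ} : coordinateColor t = some .red ↔ t < -(1 / 2) := by
  unfold coordinateColor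
  split_ifs
  · simp only [reduceCtorEq, Option.some.injEq, false_iff, not_lt]; linarith
  · exact iff_of_true rfl ‹_›
  · exact iff_of_false (by simp) ‹_›

theorem coordinateColor_eq_none_iff {t : ℝ} : coordinateColor t = none ↔ |t| ≤ 1 / 2 := by
  unfold coordinateColor
  rw [abs_le]
  split_ifs
  · simp; intros; linarith
  · simp; intros; linarith
  · simp; constructor <;> linarith

theorem coordinateColor_eq_iff {t : ℝ} (ht : t ≠ 1 / 2) (ht' : t ≠ -(1 / 2))
    {c : Option VertexColor} :
    coordinateColor t = c ↔ (1 / 2 < t ↔ c = some .blue) ∧ (t < -(1 / 2) ↔ c = some .red) ∧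
      (|t| < 1 / 2 ↔ c = none) := by
  have habs : |t| < 1 / 2 ↔ |t| ≤ 1 / 2 := by
    refine ⟨le_of_lt, fun h => lt_of_le_of_ne h fun h' => ?_⟩
    rcases (abs_eq (by norm_num)).1 h' with h | h <;> contradiction
  rw [habs, ← coordinateColor_eq_blue_iff, ← coordinateColor_eq_red_iff,
    ← coordinateColor_eq_none_iff]
  rcases c with _ | _ | _ <;> rcases coordinateColor t with _ | _ | _ <;> simp

theorem sumGraph_eq_iff {V : Type} {x : V → ℝ} {G : SimpleGraph V} :
    sumGraph x = G ↔ ∀ i j, i ≠ j → (0 < x i + x j ↔ G.Adj i j) := by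
  constructor
  · rintro rfl i j hij
    simp [sumGraph, hij]
  · intro h
    ext i j
    by_cases hij : i = j
    · subst hij; simp
    · simp [sumGraph, hij, h i j hij]

theorem coloredSumGraph_eq_iff {V : Type} {x : V → ℝ} {C : ColoredGraph V} :
    coloredSumGraph x = C ↔ sumGraph x = C.graph ∧ ∀ v, coordinateColor (x v) = C.color v := by
  constructor
  · rintro rfl
    exact ⟨rfl, fun _ => rfl⟩
  · rintro ⟨h, h'⟩
    exact congrArg₂ ColoredGraph.mk h (funext h')

theorem deleteVertex_coloredSumGraph {V : Type} (x : V → ℝ) (v : V) :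
    (coloredSumGraph x).deleteVertex v = coloredSumGraph fun w : {w : V | w ≠ v} => x w := by
  refine congrArg₂ ColoredGraph.mk ?_ rfl
  ext i j
  simp [coloredSumGraph, sumGraph, Subtype.ext_iff]

/-! ### Colored threshold graphs are the graphs of points -/

/-- The vertex to delete is one whose coordinate has the largest absolute value. -/
theorem isColoredThresholdGraph_coloredSumGraph {V : Type} [Finite V] (x : V → ℝ)
    (hx : ∀ i j, i ≠ j → x i + x j ≠ 0) : IsColoredThresholdGraph (coloredSumGraph x) := by
  induction hn : Nat.card V generalizing V with
  | zero =>
    have := (Nat.card_eq_zero.1 hn).resolve_right (not_infinite_iff_finite.2 inferInstance)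
    exact .empty _
  | succ k ih =>
    have : Nonempty V := (Nat.card_pos_iff.1 (by omega)).1
    obtain ⟨v, hv⟩ := Finite.exists_max fun w => |x w|
    have hdel : IsColoredThresholdGraph ((coloredSumGraph x).deleteVertex v) := by
      rw [deleteVertex_coloredSumGraph]
      refine ih _ (fun i j hij => hx i j fun h => hij (Subtype.ext h)) ?_
      have hc := Set.ncard_compl ({v} : Set V)
      rw [Set.ncard_singleton, hn] at hc
      exact (Nat.card_coe_set_eq _).trans hc
    have hcol : ((coloredSumGraph x).deleteVertex v).HasColored → coordinateColor (x v) ≠ none := by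
      rintro ⟨w, hw⟩
      change coordinateColor (x w) ≠ none at hw
      rw [Ne, coordinateColor_eq_none_iff] at hw ⊢
      exact fun h => hw ((hv w).trans h)
    rcases lt_or_ge 0 (x v) with hpos | hneg
    · have hred : coordinateColor (x v) ≠ some .red := by
        rw [Ne, coordinateColor_eq_red_iff]; linarith
      refine .addDominating _ v hdel (fun w hw => ⟨hw.symm, ?_⟩) (fun h => ?_) fun _ => ?_
      · have := hv w
        rw [abs_of_pos hpos] at this
        exact lt_of_le_of_ne (by linarith [neg_abs_le (x w)]) (hx v w hw.symm).symm
      · have := hcol h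
        change coordinateColor (x v) = _
        rcases hc : coordinateColor (x v) with _ | _ | _ <;> simp_all
      · change coordinateColor (x v) = _ ∨ coordinateColor (x v) = _
        rcases hc : coordinateColor (x v) with _ | _ | _ <;> simp_all
    · have hblue : coordinateColor (x v) ≠ some .blue := by
        rw [Ne, coordinateColor_eq_blue_iff]; linarith
      refine .addIsolated _ v hdel (fun w hw h => ?_) (fun h => ?_) fun _ => ?_
      · have h1 := hv w
        have h2 : 0 < x v + x w := h.2
        rw [abs_of_nonpos hneg] at h1
        linarith [le_abs_self (x w)]
      · have := hcol h
        change coordinateColor (x v) = _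
        rcases hc : coordinateColor (x v) with _ | _ | _ <;> simp_all
      · change coordinateColor (x v) = _ ∨ coordinateColor (x v) = _
        rcases hc : coordinateColor (x v) with _ | _ | _ <;> simp_all

/-- `x` lies off the hyperplanes, determines `C`, and has all its coordinates of absolute value less
than `M`, where `M < 1/2` unless some vertex is colored. -/
structure RealizesBelow {V : Type} (C : ColoredGraph V) (x : V → ℝ) (M : ℝ) : Prop where
  add_ne_zero : ∀ i j, i ≠ j → x i + x j ≠ 0
  abs_ne_half : ∀ i, |x i| ≠ 1 / 2
  coloredSumGraph_eq : coloredSumGraph x = C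
  pos : 0 < M
  abs_lt : ∀ i, |x i| < M
  lt_half : ¬ C.HasColored → M < 1 / 2

/-- A realization of `C` with `v` deleted extends to one of `C` by any coordinate `a` of larger
absolute value that has the right color and the right sign. -/
theorem RealizesBelow.extend {V : Type} {C : ColoredGraph V} {v : V} {x : {w : V | w ≠ v} → ℝ}
    {M a M' : ℝ} (h : RealizesBelow (C.deleteVertex v) x M) (hMa : M ≤ |a|) (haM' : |a| < M')
    (ha : |a| ≠ 1 / 2) (hadj : ∀ w, w ≠ v → (C.graph.Adj v w ↔ 0 < a))
    (hcol : coordinateColor a = C.color v) (hM' : ¬ C.HasColored → M' < 1 / 2) :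
    ∃ x M, RealizesBelow C x M := by
  classical
  let y : V → ℝ := fun w => if hw : w ≠ v then x ⟨w, hw⟩ else a
  have hyv : y v = a := by simp [y]
  have hyw : ∀ w (hw : w ≠ v), y w = x ⟨w, hw⟩ := fun w hw => by simp [y, hw]
  have hlt : ∀ w, w ≠ v → |y w| < |a| := fun w hw => by
    rw [hyw w hw]; exact (h.abs_lt _).trans_le hMa
  have hsign : ∀ w, w ≠ v → a + y w ≠ 0 ∧ (0 < a + y w ↔ 0 < a) := by
    intro w hw
    have h1 := hlt w hw
    rcases lt_or_ge 0 a with h0 | h0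
    · rw [abs_of_pos h0] at h1
      have h2 : 0 < a + y w := by linarith [neg_abs_le (y w)]
      exact ⟨h2.ne', iff_of_true h2 h0⟩
    · rw [abs_of_nonpos h0] at h1
      have h2 : a + y w < 0 := by linarith [le_abs_self (y w)]
      exact ⟨h2.ne, iff_of_false h2.not_gt h0.not_gt⟩
  have hgraph := coloredSumGraph_eq_iff.1 h.coloredSumGraph_eq
  refine ⟨y, M', ?_, ?_, coloredSumGraph_eq_iff.2 ⟨sumGraph_eq_iff.2 ?_, ?_⟩,
    (abs_nonneg a).trans_lt haM', ?_, hM'⟩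
  · intro i j hij
    by_cases hi : i = v
    · subst hi; rw [hyv]; exact (hsign j hij.symm).1
    · by_cases hj : j = v
      · subst hj; rw [hyv, add_comm]; exact (hsign i hij).1
      · rw [hyw i hi, hyw j hj]
        exact h.add_ne_zero _ _ fun h => hij (congrArg Subtype.val h)
  · intro i
    by_cases hi : i = v
    · subst hi; rwa [hyv]
    · rw [hyw i hi]; exact h.abs_ne_half _
  · intro i j hij
    by_cases hi : i = v
    · subst hi; rw [hyv, (hsign j hij.symm).2, hadj j hij.symm]
    · by_cases hj : j = v
      · subst hj; rw [hyv, add_comm, (hsign i hij).2, C.graph.adj_comm, hadj i hij]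
      · rw [hyw i hi, hyw j hj]
        exact sumGraph_eq_iff.1 hgraph.1 ⟨i, hi⟩ ⟨j, hj⟩ fun h => hij (congrArg Subtype.val h)
  · intro i
    by_cases hi : i = v
    · subst hi; rwa [hyv]
    · rw [hyw i hi]; exact hgraph.2 ⟨i, hi⟩
  · intro i
    by_cases hi : i = v
    · subst hi; rwa [hyv]
    · exact (hlt i hi).trans haM'

/-- If `M` bounds the previous coordinates, a new uncolored vertex gets the coordinate `± M`, which
is allowed because nothing is colored and hence `M < 1/2`. A new colored vertex gets `± (M + 1)`. -/
theorem IsColoredThresholdGraph.exists_realizesBelow {V : Type} {C : ColoredGraph V}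
    (hC : IsColoredThresholdGraph C) : ∃ x M, RealizesBelow C x M := by
  induction hC with
  | empty C =>
    exact ⟨isEmptyElim, 1 / 4, isEmptyElim, isEmptyElim,
      coloredSumGraph_eq_iff.2 ⟨sumGraph_eq_iff.2 isEmptyElim, isEmptyElim⟩, by norm_num,
      isEmptyElim, fun _ => by norm_num⟩
  | addIsolated C v _ hv hc hc' ih =>
    obtain ⟨x, M, h⟩ := ih
    have hM := h.pos
    rcases hcv : C.color v with _ | _ | _
    · have hM2 := h.lt_half fun hh => by simp [hc hh] at hcv
      have habs : |-M| = M := by rw [abs_neg, abs_of_pos hM]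
      refine h.extend (a := -M) (M' := (M + 1 / 2) / 2) habs.ge (by rw [habs]; linarith)
        (by rw [habs]; exact hM2.ne) (fun w hw => iff_of_false (hv w hw) (by linarith))
        ?_ fun _ => by linarith
      rw [hcv, coordinateColor_eq_none_iff, habs]
      exact hM2.le
    · have habs : |-(M + 1)| = M + 1 := by rw [abs_neg, abs_of_pos (by linarith)]
      refine h.extend (a := -(M + 1)) (M' := M + 2) (by rw [habs]; linarith)
        (by rw [habs]; linarith) (by rw [habs]; linarith)
        (fun w hw => iff_of_false (hv w hw) (by linarith)) ?_ fun hn => (hn ⟨v, by simp [hcv]⟩).elim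
      rw [hcv, coordinateColor_eq_red_iff]
      linarith
    · by_cases hh : (C.deleteVertex v).HasColored
      · simp [hc hh] at hcv
      · simp [hcv] at hc'
        exact (hh hc').elim
  | addDominating C v _ hv hc hc' ih =>
    obtain ⟨x, M, h⟩ := ih
    have hM := h.pos
    rcases hcv : C.color v with _ | _ | _
    · have hM2 := h.lt_half fun hh => by simp [hc hh] at hcv
      have habs : |M| = M := abs_of_pos hM
      refine h.extend (a := M) (M' := (M + 1 / 2) / 2) habs.ge (by rw [habs]; linarith)
        (by rw [habs]; exact hM2.ne) (fun w hw => iff_of_true (hv w hw) hM)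
        ?_ fun _ => by linarith
      rw [hcv, coordinateColor_eq_none_iff, habs]
      exact hM2.le
    · by_cases hh : (C.deleteVertex v).HasColored
      · simp [hc hh] at hcv
      · simp [hcv] at hc'
        exact (hh hc').elim
    · have habs : |M + 1| = M + 1 := abs_of_pos (by linarith)
      refine h.extend (a := M + 1) (M' := M + 2) (by rw [habs]; linarith)
        (by rw [habs]; linarith) (by rw [habs]; linarith)
        (fun w hw => iff_of_true (hv w hw) (by linarith)) ?_ fun hn => (hn ⟨v, by simp [hcv]⟩).elim
      rw [hcv, coordinateColor_eq_blue_iff]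
      linarith

theorem IsThresholdGraph.isColoredThresholdGraph {V : Type} {G : SimpleGraph V}
    (hG : IsThresholdGraph G) : IsColoredThresholdGraph ⟨G, fun _ => none⟩ := by
  induction hG with
  | empty G => exact .empty _
  | addIsolated G v _ hv ih =>
    exact .addIsolated _ v ih hv (fun ⟨_, h⟩ => (h rfl).elim) fun _ => .inl rfl
  | addDominating G v _ hv ih =>
    exact .addDominating _ v ih hv (fun ⟨_, h⟩ => (h rfl).elim) fun _ => .inl rfl

/-! ### Regions of the two arrangements -/

theorem mem_arrangementComplement_threshold {n : ℕ} {x : Fin n → ℝ} :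
    x ∈ arrangementComplement (thresholdArrangement n) ↔ ∀ i j, i ≠ j → x i + x j ≠ 0 := by
  simp only [arrangementComplement, thresholdArrangement, Set.mem_compl_iff, Set.mem_sUnion,
    Set.mem_ofPred_eq, not_exists, not_and]
  constructor
  · intro h i j hij h0
    rcases lt_or_gt_of_ne hij with hlt | hlt
    · exact h _ ⟨i, j, hlt, rfl⟩ h0
    · exact h _ ⟨j, i, hlt, rfl⟩ ((add_comm _ _).trans h0)
  · rintro h _ ⟨i, j, hij, rfl⟩ h0
    exact h i j hij.ne h0

theorem mem_arrangementComplement_boxedThreshold {n : ℕ} {x : Fin n → ℝ} :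
    x ∈ arrangementComplement (boxedThresholdArrangement n) ↔
      x ∈ arrangementComplement (thresholdArrangement n) ∧
        ∀ i, x i ≠ 1 / 2 ∧ x i ≠ -(1 / 2) := by
  rw [arrangementComplement, boxedThresholdArrangement, Set.sUnion_union, Set.compl_union]
  refine and_congr Iff.rfl ?_
  simp only [Set.mem_compl_iff, Set.mem_sUnion, Set.mem_ofPred_eq, not_exists, not_and]
  constructor
  · exact fun h i => ⟨fun h0 => h _ ⟨i, .inr rfl⟩ h0, fun h0 => h _ ⟨i, .inl rfl⟩ h0⟩
  · rintro h _ ⟨i, rfl | rfl⟩ h0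
    · exact (h i).2 h0
    · exact (h i).1 h0

theorem connectedComponentIn_threshold {n : ℕ} {x : Fin n → ℝ}
    (hx : x ∈ arrangementComplement (thresholdArrangement n)) :
    connectedComponentIn (arrangementComplement (thresholdArrangement n)) x =
      {y | y ∈ arrangementComplement (thresholdArrangement n) ∧ sumGraph y = sumGraph x} := by
  let coord : Fin n → (Fin n → ℝ) →L[ℝ] ℝ := ContinuousLinearMap.proj
  let l : {p : Fin n × Fin n // p.1 ≠ p.2} → (Fin n → ℝ) →L[ℝ] ℝ := fun p =>
    coord p.1.1 + coord p.1.2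
  have hl : ∀ p y, l p y = y p.1.1 + y p.1.2 := fun _ _ => rfl
  have hF : arrangementComplement (thresholdArrangement n) = {y | ∀ p, l p y ≠ 0} := by
    ext y
    simp [mem_arrangementComplement_threshold, hl]
  rw [hF] at hx ⊢
  rw [connectedComponentIn_compl_hyperplanes l (fun _ => 0) hx]
  ext y
  refine and_congr_right fun _ => ?_
  rw [sumGraph_eq_iff]
  simp +contextual [hl, sumGraph]

theorem connectedComponentIn_boxedThreshold {n : ℕ} {x : Fin n → ℝ}
    (hx : x ∈ arrangementComplement (boxedThresholdArrangement n)) :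
    connectedComponentIn (arrangementComplement (boxedThresholdArrangement n)) x =
      {y | y ∈ arrangementComplement (boxedThresholdArrangement n) ∧
        coloredSumGraph y = coloredSumGraph x} := by
  let coord : Fin n → (Fin n → ℝ) →L[ℝ] ℝ := ContinuousLinearMap.proj
  let l : {p : Fin n × Fin n // p.1 ≠ p.2} ⊕ Fin n ⊕ Fin n → (Fin n → ℝ) →L[ℝ] ℝ :=
    Sum.elim (fun p => coord p.1.1 + coord p.1.2) (Sum.elim coord coord)
  let c : {p : Fin n × Fin n // p.1 ≠ p.2} ⊕ Fin n ⊕ Fin n → ℝ :=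
    Sum.elim (fun _ => 0) (Sum.elim (fun _ => 1 / 2) fun _ => -(1 / 2))
  have hF : arrangementComplement (boxedThresholdArrangement n) = {y | ∀ p, l p y ≠ c p} := by
    ext y
    simp [mem_arrangementComplement_boxedThreshold, mem_arrangementComplement_threshold, l, c, coord,
      Sum.forall, forall_and]
  have hx' := mem_arrangementComplement_boxedThreshold.1 hx
  have hx2 := hx
  rw [hF] at hx2
  rw [hF, connectedComponentIn_compl_hyperplanes l c hx2]
  ext y
  change (y ∈ {y | ∀ p, l p y ≠ c p} ∧ _) ↔ y ∈ {y | ∀ p, l p y ≠ c p} ∧ _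
  rw [← hF]
  refine and_congr_right fun hy => ?_
  have hy' := mem_arrangementComplement_boxedThreshold.1 hy
  rw [coloredSumGraph_eq_iff]
  change _ ↔ sumGraph y = sumGraph x ∧ ∀ v, coordinateColor (y v) = coordinateColor (x v)
  have hcol : ∀ v, coordinateColor (y v) = coordinateColor (x v) ↔
      (1 / 2 < y v ↔ 1 / 2 < x v) ∧ (-(1 / 2) < y v ↔ -(1 / 2) < x v) := by
    intro v
    have hlt : ∀ {z : Fin n → ℝ}, z v ≠ -(1 / 2) → (-(1 / 2) < z v ↔ ¬ z v < -(1 / 2)) :=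
      fun hz => ⟨fun h => h.le.not_gt, fun h => lt_of_le_of_ne (not_lt.1 h) hz.symm⟩
    rw [hlt (hy'.2 v).2, hlt (hx'.2 v).2, not_iff_not, ← coordinateColor_eq_blue_iff,
      ← coordinateColor_eq_blue_iff, ← coordinateColor_eq_red_iff, ← coordinateColor_eq_red_iff]
    rcases coordinateColor (x v) with _ | _ | _ <;>
      rcases coordinateColor (y v) with _ | _ | _ <;> simp
  simp only [hcol, forall_and, sumGraph_eq_iff]
  simp +contextual [l, c, coord, Sum.forall, sumGraph]

theorem IsColoredThresholdGraph.exists_coloredSumGraph_eq {n : ℕ} {C : ColoredGraph (Fin n)}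
    (hC : IsColoredThresholdGraph C) :
    ∃ x ∈ arrangementComplement (boxedThresholdArrangement n), coloredSumGraph x = C := by
  obtain ⟨x, M, h⟩ := hC.exists_realizesBelow
  refine ⟨x, mem_arrangementComplement_boxedThreshold.2
    ⟨mem_arrangementComplement_threshold.2 h.add_ne_zero, fun i => ⟨fun h0 => ?_, fun h0 => ?_⟩⟩,
    h.coloredSumGraph_eq⟩ <;>
  exact h.abs_ne_half i (by rw [h0]; norm_num)

/-- The direction in which a coordinate of a given color can be moved without changing the graph. -/
def VertexColor.direction : Option VertexColor → ℝ
  | none => 0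
  | some .blue => 1
  | some .red => -1

/-- Blue coordinates may be increased and red ones decreased by a common amount: a blue coordinate
already exceeds the absolute value of every uncolored one, and a red one is below its negative. -/
theorem coloredSumGraph_add_direction {n : ℕ} {x y : Fin n → ℝ}
    (hx : x ∈ arrangementComplement (boxedThresholdArrangement n)) {s : ℝ} (hs : 0 ≤ s)
    (hy : ∀ i, y i = x i + s * VertexColor.direction (coordinateColor (x i))) :
    y ∈ arrangementComplement (boxedThresholdArrangement n) ∧
      coloredSumGraph y = coloredSumGraph x := by
  have hx' := mem_arrangementComplement_boxedThreshold.1 hx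
  have hcases : ∀ i, (1 / 2 < x i ∧ y i = x i + s) ∨ (x i < -(1 / 2) ∧ y i = x i - s) ∨
      (-(1 / 2) < x i ∧ x i < 1 / 2 ∧ y i = x i) := by
    intro i
    rcases hc : coordinateColor (x i) with _ | _ | _
    · have h := abs_le.1 (coordinateColor_eq_none_iff.1 hc)
      exact .inr (.inr ⟨lt_of_le_of_ne h.1 (hx'.2 i).2.symm, lt_of_le_of_ne h.2 (hx'.2 i).1,
        by simp [hy, hc, VertexColor.direction]⟩)
    · exact .inr (.inl ⟨coordinateColor_eq_red_iff.1 hc,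
        by simp [hy, hc, VertexColor.direction, sub_eq_add_neg]⟩)
    · exact .inl ⟨coordinateColor_eq_blue_iff.1 hc, by simp [hy, hc, VertexColor.direction]⟩
  have hsum : ∀ i j, i ≠ j → y i + y j ≠ 0 ∧ (0 < y i + y j ↔ 0 < x i + x j) := by
    intro i j hij
    have hne := mem_arrangementComplement_threshold.1 hx'.1 i j hij
    rcases lt_or_gt_of_ne hne with h | h
    · have : y i + y j < 0 := by
        rcases hcases i with h1 | h1 | h1 <;> rcases hcases j with h2 | h2 | h2 <;> linarith
      exact ⟨this.ne, iff_of_false this.not_gt h.not_gt⟩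
    · have : 0 < y i + y j := by
        rcases hcases i with h1 | h1 | h1 <;> rcases hcases j with h2 | h2 | h2 <;> linarith
      exact ⟨this.ne', iff_of_true this h⟩
  have hval : ∀ i, (y i ≠ 1 / 2 ∧ y i ≠ -(1 / 2)) ∧
      coordinateColor (y i) = coordinateColor (x i) := by
    intro i
    rcases hcases i with ⟨h, h'⟩ | ⟨h, h'⟩ | ⟨h, h1, h'⟩
    · refine ⟨⟨by linarith, by linarith⟩, ?_⟩
      rw [coordinateColor_eq_blue_iff.2 h, coordinateColor_eq_blue_iff]
      linarith
    · refine ⟨⟨by linarith, by linarith⟩, ?_⟩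
      rw [coordinateColor_eq_red_iff.2 h, coordinateColor_eq_red_iff]
      linarith
    · exact ⟨h' ▸ hx'.2 i, by rw [h']⟩
  refine ⟨mem_arrangementComplement_boxedThreshold.2
    ⟨mem_arrangementComplement_threshold.2 fun i j hij => (hsum i j hij).1, fun i => (hval i).1⟩,
    coloredSumGraph_eq_iff.2 ⟨sumGraph_eq_iff.2 fun i j hij => ?_, fun i => (hval i).2⟩⟩
  rw [(hsum i j hij).2]
  simp [coloredSumGraph, sumGraph, hij]

theorem isBounded_fiber_coloredSumGraph_iff {n : ℕ} {C : ColoredGraph (Fin n)}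
    (hC : IsColoredThresholdGraph C) :
    Bornology.IsBounded {x | x ∈ arrangementComplement (boxedThresholdArrangement n) ∧
      coloredSumGraph x = C} ↔ ∀ i, C.color i = none := by
  constructor
  · intro hb i
    by_contra hi
    obtain ⟨x, hx, rfl⟩ := hC.exists_coloredSumGraph_eq
    obtain ⟨M, hM⟩ := hb.exists_norm_le
    have hdir : |VertexColor.direction (coordinateColor (x i))| = 1 := by
      change coordinateColor (x i) ≠ none at hi
      rcases hc : coordinateColor (x i) with _ | _ | _
      · exact (hi hc).elim
      · simp [VertexColor.direction]
      · simp [VertexColor.direction]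
    have hs : 0 ≤ |M| + |x i| + 1 := by positivity
    -- Moving by `|M| + |x i| + 1` takes the `i`-th coordinate beyond the bound `M`.
    let y : Fin n → ℝ := fun j =>
      x j + (|M| + |x i| + 1) * VertexColor.direction (coordinateColor (x j))
    have hy : |y i| ≤ M := (norm_le_pi_norm y i).trans
      (hM y (coloredSumGraph_add_direction hx hs fun _ => rfl))
    have htri := abs_sub_abs_le_abs_sub (y i - x i) (y i)
    have h1 : |y i - x i| = |M| + |x i| + 1 := by
      simp only [y, add_sub_cancel_left]
      rw [abs_mul, hdir, mul_one, abs_of_nonneg hs]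
    rw [h1, sub_sub_cancel_left, abs_neg] at htri
    linarith [le_abs_self M]
  · intro h
    refine (Metric.isBounded_closedBall (x := (0 : Fin n → ℝ)) (r := 1 / 2)).subset ?_
    rintro x ⟨_, hxC⟩
    rw [mem_closedBall_zero_iff, pi_norm_le_iff_of_nonneg (by norm_num)]
    intro i
    rw [Real.norm_eq_abs, ← coordinateColor_eq_none_iff, (coloredSumGraph_eq_iff.1 hxC).2, h]

theorem mainTheorem9 (n : ℕ) :
    ∃ (Φ : LabeledColoredThresholdGraph n ≃ arrangementRegions (boxedThresholdArrangement n))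
      (Ψ : LabeledThresholdGraph n ≃ arrangementRegions (thresholdArrangement n))
      (β : {R : arrangementRegions (boxedThresholdArrangement n) //
          Bornology.IsBounded (R : Set (Fin n → ℝ))} ≃
        arrangementRegions (thresholdArrangement n)),
      -- the region of a labeled colored threshold graph
      (∀ C : LabeledColoredThresholdGraph n,
        ∀ x ∈ arrangementComplement (boxedThresholdArrangement n),
          x ∈ (Φ C : Set (Fin n → ℝ)) ↔
            (∀ i j : Fin n, i ≠ j → (0 < x i + x j ↔ C.1.graph.Adj i j)) ∧
            (∀ i : Fin n,
              (1 / 2 < x i ↔ C.1.color i = some VertexColor.blue) ∧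
              (x i < -(1 / 2) ↔ C.1.color i = some VertexColor.red) ∧
              (|x i| < 1 / 2 ↔ C.1.color i = none))) ∧
      -- the region of a labeled threshold graph
      (∀ G : LabeledThresholdGraph n,
        ∀ x ∈ arrangementComplement (thresholdArrangement n),
          x ∈ (Ψ G : Set (Fin n → ℝ)) ↔
            ∀ i j : Fin n, i ≠ j → (0 < x i + x j ↔ G.1.Adj i j)) ∧
      -- forgetting colors gives the region of the threshold arrangement that contains the region
      (∀ (C : LabeledColoredThresholdGraph n) (R : arrangementRegions (thresholdArrangement n)),
        (Φ C : Set (Fin n → ℝ)) ⊆ (R : Set (Fin n → ℝ)) ↔ R = Ψ C.forgetColors) ∧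
      -- the bounded regions are those of the uncolored graphs
      (∀ C : LabeledColoredThresholdGraph n,
        Bornology.IsBounded (Φ C : Set (Fin n → ℝ)) ↔ ∀ i : Fin n, C.1.color i = none) ∧
      -- bounded regions correspond to regions of the threshold arrangement
      (∀ B : {R : arrangementRegions (boxedThresholdArrangement n) //
          Bornology.IsBounded (R : Set (Fin n → ℝ))},
        β B = Ψ (Φ.symm B.1).forgetColors ∧
        (B.1 : Set (Fin n → ℝ)) =
          (β B : Set (Fin n → ℝ)) ∩ {x | ∀ i : Fin n, -(1 / 2) < x i ∧ x i < 1 / 2}) := by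
  obtain ⟨Φ, hΦ⟩ : ∃ Φ : LabeledColoredThresholdGraph n ≃
        arrangementRegions (boxedThresholdArrangement n),
      ∀ C : LabeledColoredThresholdGraph n, (Φ C : Set (Fin n → ℝ)) =
        {x | x ∈ arrangementComplement (boxedThresholdArrangement n) ∧
          coloredSumGraph x = C.1} := exists_equiv_arrangementRegions
    IsColoredThresholdGraph coloredSumGraph (fun _ => connectedComponentIn_boxedThreshold)
    (fun x hx => isColoredThresholdGraph_coloredSumGraph x (mem_arrangementComplement_threshold.1
      (mem_arrangementComplement_boxedThreshold.1 hx).1))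
    fun _ hC => hC.exists_coloredSumGraph_eq
  obtain ⟨Ψ, hΨ⟩ : ∃ Ψ : LabeledThresholdGraph n ≃
        arrangementRegions (thresholdArrangement n),
      ∀ G : LabeledThresholdGraph n, (Ψ G : Set (Fin n → ℝ)) =
        {x | x ∈ arrangementComplement (thresholdArrangement n) ∧ sumGraph x = G.1} :=
    exists_equiv_arrangementRegions
    IsThresholdGraph sumGraph (fun _ => connectedComponentIn_threshold)
    (fun x hx => (isColoredThresholdGraph_coloredSumGraph x
      (mem_arrangementComplement_threshold.1 hx)).isThresholdGraph)
    fun G hG => by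
      obtain ⟨x, hx, hxG⟩ := hG.isColoredThresholdGraph.exists_coloredSumGraph_eq
      exact ⟨x, (mem_arrangementComplement_boxedThreshold.1 hx).1,
        (coloredSumGraph_eq_iff.1 hxG).1⟩
  have hbdd : ∀ C : LabeledColoredThresholdGraph n,
      Bornology.IsBounded (Φ C : Set (Fin n → ℝ)) ↔ ∀ i : Fin n, C.1.color i = none := fun C => by
    rw [hΦ]
    exact isBounded_fiber_coloredSumGraph_iff C.2
  have hbdd' : ∀ B : {R : arrangementRegions (boxedThresholdArrangement n) //
      Bornology.IsBounded (R : Set (Fin n → ℝ))}, ∀ i, (Φ.symm B.1).1.color i = none := fun B =>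
    (hbdd _).1 (by rw [Equiv.apply_symm_apply]; exact B.2)
  let f : {R : arrangementRegions (boxedThresholdArrangement n) //
      Bornology.IsBounded (R : Set (Fin n → ℝ))} → arrangementRegions (thresholdArrangement n) :=
    fun B => Ψ (Φ.symm B.1).forgetColors
  have hf : Function.Bijective f := by
    constructor
    · intro B B' h
      have hgraph : (Φ.symm B.1).1.graph = (Φ.symm B'.1).1.graph :=
        congrArg Subtype.val (Ψ.injective h)
      have hcolor : (Φ.symm B.1).1.color = (Φ.symm B'.1).1.color :=
        funext fun i => (hbdd' B i).trans (hbdd' B' i).symm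
      exact Subtype.ext (Φ.symm.injective
        (Subtype.ext (congrArg₂ ColoredGraph.mk hgraph hcolor)))
    · intro R
      let C : LabeledColoredThresholdGraph n :=
        ⟨⟨(Ψ.symm R).1, fun _ => none⟩, (Ψ.symm R).2.isColoredThresholdGraph⟩
      refine ⟨⟨Φ C, (hbdd C).2 fun _ => rfl⟩, ?_⟩
      have hforget : C.forgetColors = Ψ.symm R := rfl
      simp only [f, Equiv.symm_apply_apply, hforget, Equiv.apply_symm_apply]
  refine ⟨Φ, Ψ, Equiv.ofBijective f hf, ?_, ?_, ?_, hbdd, ?_⟩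
  · intro C x hx
    have hx' := (mem_arrangementComplement_boxedThreshold.1 hx).2
    rw [hΦ]
    simp only [Set.mem_ofPred_eq, hx, true_and, coloredSumGraph_eq_iff, sumGraph_eq_iff,
      coordinateColor_eq_iff (hx' _).1 (hx' _).2]
  · intro G x hx
    rw [hΨ]
    simp only [Set.mem_ofPred_eq, hx, true_and, sumGraph_eq_iff]
  · intro C R
    obtain ⟨G, rfl⟩ := Ψ.surjective R
    rw [hΦ, hΨ, Ψ.apply_eq_iff_eq]
    constructor
    · intro h
      obtain ⟨x, hx, hxC⟩ := C.2.exists_coloredSumGraph_eq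
      exact Subtype.ext ((h ⟨hx, hxC⟩).2.symm.trans (coloredSumGraph_eq_iff.1 hxC).1)
    · rintro rfl x ⟨hx, hxC⟩
      exact ⟨(mem_arrangementComplement_boxedThreshold.1 hx).1, (coloredSumGraph_eq_iff.1 hxC).1⟩
  · intro B
    refine ⟨rfl, ?_⟩
    obtain ⟨C, hC⟩ := Φ.surjective B.1
    have hnone := hbdd' B
    change (B.1 : Set (Fin n → ℝ)) = (Ψ (Φ.symm B.1).forgetColors : Set (Fin n → ℝ)) ∩ _
    rw [← hC, Equiv.symm_apply_apply] at hnone ⊢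
    rw [hΦ, hΨ]
    ext x
    constructor
    · rintro ⟨hx, hxC⟩
      have hx' := mem_arrangementComplement_boxedThreshold.1 hx
      rw [coloredSumGraph_eq_iff] at hxC
      refine ⟨⟨hx'.1, hxC.1⟩, fun i => ?_⟩
      have hle := abs_le.1 (coordinateColor_eq_none_iff.1 ((hxC.2 i).trans (hnone i)))
      exact ⟨lt_of_le_of_ne hle.1 (hx'.2 i).2.symm, lt_of_le_of_ne hle.2 (hx'.2 i).1⟩
    · rintro ⟨⟨hx, hxG⟩, hbox⟩
      refine ⟨mem_arrangementComplement_boxedThreshold.2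
        ⟨hx, fun i => ⟨(hbox i).2.ne, (hbox i).1.ne'⟩⟩, coloredSumGraph_eq_iff.2
        ⟨hxG, fun i => ?_⟩⟩
      rw [hnone, coordinateColor_eq_none_iff]
      exact (abs_lt.2 (hbox i)).le
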